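/- Let $k$ be a field of characteristic $0$, and let $\Theta$ be the variety of all Jordan algebras over $k$, that is, of all (not necessarily unital, not necessarily associative) $k$-algebras satisfying the identities $xy=yx$ and $((xx)y)x=(xx)(yx)$. Fix a countably infinite set of symbols $X_0=\{x_1,x_2,\dots\}$ and let $\Theta^0$ be the category whose objects are the free Jordan algebras $F(X)$ over $k$ on the finite subsets $X\subset X_0$ (one object for each $X$, with $X=\varnothing$ allowed) and whose morphisms are all homomorphisms of $k$-algebras. Let $\mathfrak{A}$ be the group, under composition, of all automorphisms of the category $\Theta^0$ (functors $\Theta^0\to\Theta^0$ with a strict two-sided inverse), and let $\mathfrak{Y}$ be the normal subgroup of inner automorphisms, i.e. of those automorphisms that are isomorphic, as functors, to the identity functor of $\Theta^0$. Then there is an isomorphism of groups $$\mathfrak{A}/\mathfrak{Y}\;\cong\;\mathrm{Aut}\,k,$$ where $\mathrm{Aut}\,k$ is the group of all field automorphisms of $k$. -/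

import Mathlib

open CategoryTheory

universe u

noncomputable section

section FreeJordan

variable (k : Type u) [Field k] (X : Type)

/-- The relation on the absolutely free (non-unital, non-associative) `k`-algebra on `X`
that generates the congruence of all consequences of the laws `a b = b a` and
`((a a) b) a = (a a) (b a)`. -/
inductive FreeJordanRel :
    FreeNonUnitalNonAssocAlgebra k X → FreeNonUnitalNonAssocAlgebra k X → Prop
  | mul_comm (a b : FreeNonUnitalNonAssocAlgebra k X) : FreeJordanRel (a * b) (b * a)
  | jordan (a b : FreeNonUnitalNonAssocAlgebra k X) :
      FreeJordanRel (((a * a) * b) * a) ((a * a) * (b * a))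
  | smul (t : k) {a b : FreeNonUnitalNonAssocAlgebra k X} :
      FreeJordanRel a b → FreeJordanRel (t • a) (t • b)
  | add_right {a b : FreeNonUnitalNonAssocAlgebra k X} (c : FreeNonUnitalNonAssocAlgebra k X) :
      FreeJordanRel a b → FreeJordanRel (a + c) (b + c)
  | mul_left (a : FreeNonUnitalNonAssocAlgebra k X) {b c : FreeNonUnitalNonAssocAlgebra k X} :
      FreeJordanRel b c → FreeJordanRel (a * b) (a * c)
  | mul_right {a b : FreeNonUnitalNonAssocAlgebra k X} (c : FreeNonUnitalNonAssocAlgebra k X) :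
      FreeJordanRel a b → FreeJordanRel (a * c) (b * c)

/-- The free Jordan algebra over `k` (not assumed to have a unit) on the set `X`: the quotient
of the absolutely free algebra by the congruence generated by the Jordan algebra laws. -/
def FreeJordanAlgebra : Type u := Quot (FreeJordanRel k X)

end FreeJordan

namespace FreeJordanAlgebra

variable (k : Type u) [Field k] (X : Type)

theorem rel_add_left (a : FreeNonUnitalNonAssocAlgebra k X)
    {b c : FreeNonUnitalNonAssocAlgebra k X} (h : FreeJordanRel k X b c) :
    FreeJordanRel k X (a + b) (a + c) := by
  rw [add_comm a b, add_comm a c]; exact h.add_right a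

theorem rel_neg {a b : FreeNonUnitalNonAssocAlgebra k X} (h : FreeJordanRel k X a b) :
    FreeJordanRel k X (-a) (-b) := by
  simpa only [neg_one_smul] using h.smul (-1)

theorem rel_nsmul (n : ℕ) (a b : FreeNonUnitalNonAssocAlgebra k X) (h : FreeJordanRel k X a b) :
    FreeJordanRel k X (n • a) (n • b) := by
  simpa only [Nat.cast_smul_eq_nsmul] using h.smul (n : k)

theorem rel_zsmul (n : ℤ) (a b : FreeNonUnitalNonAssocAlgebra k X) (h : FreeJordanRel k X a b) :
    FreeJordanRel k X (n • a) (n • b) := by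
  simpa only [Int.cast_smul_eq_zsmul] using h.smul (n : k)

instance : Zero (FreeJordanAlgebra k X) where zero := Quot.mk _ 0

instance : Add (FreeJordanAlgebra k X) where
  add := Quot.map₂ (· + ·) (fun a _ _ h => rel_add_left k X a h) fun _ _ c h => h.add_right c

instance : Neg (FreeJordanAlgebra k X) where
  neg := Quot.map Neg.neg fun _ _ h => rel_neg k X h

instance : Sub (FreeJordanAlgebra k X) where
  sub := Quot.map₂ Sub.sub
    (fun a b c h => by
      change FreeJordanRel k X (a - b) (a - c)
      simpa only [sub_eq_add_neg] using rel_add_left k X a (rel_neg k X h))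
    fun a b c h => by
      change FreeJordanRel k X (a - c) (b - c)
      simpa only [sub_eq_add_neg] using h.add_right (-c)

instance : Mul (FreeJordanAlgebra k X) where
  mul := Quot.map₂ (· * ·) (fun a _ _ h => h.mul_left a) fun _ _ c h => h.mul_right c

instance : SMul k (FreeJordanAlgebra k X) where
  smul t := Quot.map (t • ·) fun _ _ h => h.smul t

instance : SMul ℕ (FreeJordanAlgebra k X) where
  smul n := Quot.map (n • ·) (rel_nsmul k X n)

instance : SMul ℤ (FreeJordanAlgebra k X) where
  smul n := Quot.map (n • ·) (rel_zsmul k X n)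

instance : NonUnitalNonAssocRing (FreeJordanAlgebra k X) :=
  Function.Surjective.nonUnitalNonAssocRing (Quot.mk _) Quot.mk_surjective rfl
    (fun _ _ => rfl) (fun _ _ => rfl) (fun _ => rfl) (fun _ _ => rfl)
    (fun _ _ => rfl) (fun _ _ => rfl)

instance : NonUnitalNonAssocCommRing (FreeJordanAlgebra k X) where
  mul_comm := by
    rintro ⟨a⟩ ⟨b⟩
    exact Quot.sound (FreeJordanRel.mul_comm a b)

instance : Module k (FreeJordanAlgebra k X) :=
  Function.Surjective.module k
    (⟨⟨Quot.mk (FreeJordanRel k X), rfl⟩, fun _ _ => rfl⟩ :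
      FreeNonUnitalNonAssocAlgebra k X →+ FreeJordanAlgebra k X)
    Quot.mk_surjective (fun _ _ => rfl)

instance : IsScalarTower k (FreeJordanAlgebra k X) (FreeJordanAlgebra k X) where
  smul_assoc := by
    rintro t ⟨a⟩ ⟨b⟩
    exact congrArg (Quot.mk (FreeJordanRel k X)) (smul_mul_assoc t a b)

instance : SMulCommClass k (FreeJordanAlgebra k X) (FreeJordanAlgebra k X) where
  smul_comm := by
    rintro t ⟨a⟩ ⟨b⟩
    exact congrArg (Quot.mk (FreeJordanRel k X)) (mul_smul_comm t a b).symm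

instance : IsCommJordan (FreeJordanAlgebra k X) where
  lmul_comm_rmul_rmul := by
    intro a b
    have h : ((a * a) * b) * a = (a * a) * (b * a) := by
      obtain ⟨a, rfl⟩ := Quot.mk_surjective a
      obtain ⟨b, rfl⟩ := Quot.mk_surjective b
      exact Quot.sound (FreeJordanRel.jordan a b)
    rw [mul_comm (a * b), mul_comm a b, ← h, mul_comm _ a, mul_comm (a * a) b]

/-- The canonical image of a free generator. -/
def of (x : X) : FreeJordanAlgebra k X :=
  Quot.mk _ (FreeNonUnitalNonAssocAlgebra.of k x)

end FreeJordanAlgebra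

/-- An object of the category of finitely generated free Jordan algebras over `k`: the free
algebra `F(X)` on a finite subset `X` of a fixed countable set of symbols, here indexed by `ℕ`
(the empty subset is allowed). Different subsets give different objects. -/
@[ext]
structure FreeJordanCat (k : Type u) [Field k] : Type where
  gens : Finset ℕ

namespace FreeJordanCat

variable (k : Type u) [Field k]

/-- The free Jordan algebra `F(X)` underlying an object. -/
abbrev algebra (A : FreeJordanCat k) : Type u := FreeJordanAlgebra k A.gens

/-- Morphisms are all homomorphisms of `k`-algebras. -/
instance : Category.{u} (FreeJordanCat k) where
  Hom A B := A.algebra k →ₙₐ[k] B.algebra k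
  id A := NonUnitalAlgHom.id k (A.algebra k)
  comp f g := NonUnitalAlgHom.comp g f

/-- The group of all automorphisms of the category, i.e. of all functors from the category to
itself that have a strict two-sided inverse; the product is the composition. -/
abbrev AutGroup : Type u := Aut (Cat.of (FreeJordanCat k))

/-- The normal subgroup of all inner automorphisms: those isomorphic, as functors, to the identity
functor. -/
def innerSubgroup : Subgroup (AutGroup k) where
  carrier := {Φ | Nonempty (𝟭 (FreeJordanCat k) ≅ Φ.hom.toFunctor)}
  one_mem' := ⟨Iso.refl _⟩
  mul_mem' := by
    rintro Φ Ψ ⟨e⟩ ⟨f⟩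
    exact ⟨f ≪≫ (Functor.rightUnitor _).symm ≪≫ Functor.isoWhiskerLeft Ψ.hom.toFunctor e⟩
  inv_mem' := by
    rintro Φ ⟨e⟩
    exact ⟨eqToIso (congrArg Cat.Hom.toFunctor Φ.hom_inv_id).symm ≪≫
      (Functor.isoWhiskerRight e Φ.inv.toFunctor).symm ≪≫ Functor.leftUnitor _⟩

instance : (innerSubgroup k).Normal where
  conj_mem := by
    rintro Φ ⟨e⟩ Ψ
    exact ⟨eqToIso (congrArg Cat.Hom.toFunctor Ψ.inv_hom_id).symm ≪≫
      Functor.isoWhiskerLeft Ψ.inv.toFunctor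
        ((Functor.leftUnitor _).symm ≪≫ Functor.isoWhiskerRight e Ψ.hom.toFunctor)⟩

end FreeJordanCat

end

/-! A field automorphism `φ` twists morphisms by conjugation with the `φ`-semilinear map that fixes
the generators. The resulting map from `RingAut k` to the quotient is shown to be bijective.

Let F₁, F₂ be the free algebras of rank one and two. Elements of an algebra A are the morphisms F₁ →
A. An autoequivalence Φ sends F₁ to an algebra of rank one: F₁ is a retract of every nonzero object,
and a retract of F₁ has rank at most one (`subsingleton_of_retract`). Hence Φ induces natural
bijections T : A → Φ A (`transport`).

Jordan algebras are power associative, so F₁ is the algebra of polynomials without constant term and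
its automorphisms are homotheties (`exists_eq_smul_of`); hence T(ca) = σ(c)T(a). Sum and product
pulled back along T are given by elements of F₂, and homogeneity under scaling leaves only x + y
(`transport_add`) and γxy with γ ≠ 0 (`exists_transport_mul`). So σ is a field automorphism, a
scalar multiple of T is a natural σ-semilinear ring isomorphism, and Φ is isomorphic to the twist by
σ.

Conversely, an isomorphism from the identity to the twist by `φ` is a homothety on F₁, and
naturality at x ↦ cx gives `φ c = c`. -/

noncomputable section

/-- The powers `a`, `a * a`, `a * (a * a)`, …, so that `jordanPow a n` is the power of exponent
`n + 1`. -/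
def jordanPow {A : Type*} [Mul A] (a : A) : ℕ → A
  | 0 => a
  | n + 1 => a * jordanPow a n

/-! ### Power associativity of Jordan algebras. -/

section PowerAssociative

variable {A : Type*} [NonUnitalNonAssocCommRing A] [IsCommJordan A]

theorem jordan_linearized (h2 : ∀ z : A, 2 • z = 0 → z = 0) (x y z u : A) :
    x * ((y * z) * u) + y * ((z * x) * u) + z * ((x * y) * u) =
      (y * z) * (x * u) + (z * x) * (y * u) + (x * y) * (z * u) := by
  have h := DFunLike.congr_fun (two_nsmul_lie_lmul_lmul_add_add_eq_zero x y z) u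
  have h' : 2 • ((x * ((y * z) * u) - (y * z) * (x * u)) +
      (y * ((z * x) * u) - (z * x) * (y * u)) + (z * ((x * y) * u) - (x * y) * (z * u))) = 0 := h
  have h'' := h2 _ h'
  rw [← sub_eq_zero, ← h'']
  abel

/-- The linearized identity expresses multiplication by a power through multiplications by the two
preceding powers, by `a` and by `a * a`; hence the two-step induction. -/
theorem jordanPow_commute (h2 : ∀ z : A, 2 • z = 0 → z = 0) (a : A) (n : ℕ) :
    (∀ w, jordanPow a n * (a * w) = a * (jordanPow a n * w)) ∧
      ∀ w, jordanPow a n * ((a * a) * w) = (a * a) * (jordanPow a n * w) := by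
  have hsq (w : A) : (a * a) * (a * w) = a * ((a * a) * w) := IsJordan.lmul_lmul_comm_lmul a w
  induction n using Nat.twoStepInduction with
  | zero => exact ⟨fun w => rfl, fun w => (hsq w).symm⟩
  | one => exact ⟨hsq, fun w => rfl⟩
  | more n h0 h1 =>
    have key (w : A) : jordanPow a (n + 2) * w =
        jordanPow a (n + 1) * (a * w) + jordanPow a (n + 1) * (a * w)
          + (a * a) * (jordanPow a n * w) - jordanPow a n * (a * (a * w))
          - a * (a * (jordanPow a n * w)) := by
      have h := jordan_linearized h2 w (jordanPow a n) a a
      have e1 : jordanPow a n * a = jordanPow a (n + 1) := mul_comm _ _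
      have e2 : jordanPow a (n + 1) * a = jordanPow a (n + 2) := mul_comm _ _
      rw [e1, e2, mul_comm w (jordanPow a (n + 2)), mul_comm (a * w) a,
        mul_comm (w * jordanPow a n) a, mul_comm w (jordanPow a n), mul_comm w a,
        mul_comm (a * w) (jordanPow a (n + 1)),
        mul_comm (jordanPow a n * w) (a * a)] at h
      rw [eq_sub_iff_add_eq, eq_sub_iff_add_eq]
      rw [← sub_eq_zero] at h ⊢
      rw [← h]
      abel
    constructor
    · intro w
      simp only [key, h0.1, h1.1, hsq, mul_add, mul_sub]
    · intro w
      simp only [key, h0.1, h0.2, h1.1, h1.2, hsq, mul_add, mul_sub]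

theorem jordanPow_mul (h2 : ∀ z : A, 2 • z = 0 → z = 0) (a : A) (m n : ℕ) :
    jordanPow a m * jordanPow a n = jordanPow a (m + n + 1) := by
  induction n with
  | zero => exact mul_comm _ _
  | succ n ih =>
    change jordanPow a m * (a * jordanPow a n) = a * jordanPow a (m + n + 1)
    rw [(jordanPow_commute h2 a m).1, ih]

end PowerAssociative

namespace FreeJordanAlgebra

/-! ### Universal property and spanning by monomials. -/

section Lift

variable (k : Type u) [Field k] {X : Type}

/-- The quotient map from the absolutely free algebra. -/
def proj : FreeNonUnitalNonAssocAlgebra k X →ₙₐ[k] FreeJordanAlgebra k X where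
  toFun := Quot.mk _
  map_smul' _ _ := rfl
  map_zero' := rfl
  map_add' _ _ := rfl
  map_mul' _ _ := rfl

variable {A : Type*} [NonUnitalNonAssocCommRing A] [Module k A] [IsScalarTower k A A]
  [SMulCommClass k A A]

/-- The homomorphism to a Jordan algebra determined by the images of the free generators. -/
def lift [IsCommJordan A] (f : X → A) : FreeJordanAlgebra k X →ₙₐ[k] A where
  toFun := Quot.lift (FreeNonUnitalNonAssocAlgebra.lift k f) fun a b h => by
    induction h with
    | mul_comm a b => simp only [map_mul, mul_comm]
    | jordan a b => simp only [map_mul]; exact (IsJordan.lmul_lmul_comm_rmul _ _).symm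
    | smul t _ ih => simp only [map_smul, ih]
    | add_right c _ ih => simp only [map_add, ih]
    | mul_left a _ ih => simp only [map_mul, ih]
    | mul_right c _ ih => simp only [map_mul, ih]
  map_smul' t := by rintro ⟨a⟩; exact map_smul (FreeNonUnitalNonAssocAlgebra.lift k f) t a
  map_zero' := map_zero (FreeNonUnitalNonAssocAlgebra.lift k f)
  map_add' := by rintro ⟨a⟩ ⟨b⟩; exact map_add (FreeNonUnitalNonAssocAlgebra.lift k f) a b
  map_mul' := by rintro ⟨a⟩ ⟨b⟩; exact map_mul (FreeNonUnitalNonAssocAlgebra.lift k f) a b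

@[simp]
theorem lift_of [IsCommJordan A] (f : X → A) (x : X) : lift k f (of k X x) = f x :=
  FreeNonUnitalNonAssocAlgebra.lift_of_apply k f x

variable {k}

theorem hom_ext {f g : FreeJordanAlgebra k X →ₙₐ[k] A} (h : ∀ x, f (of k X x) = g (of k X x)) :
    f = g := by
  have h' : f.comp (proj k) = g.comp (proj k) := FreeNonUnitalNonAssocAlgebra.hom_ext k h
  ext ⟨a⟩
  exact DFunLike.congr_fun h' a

variable (k)

/-- The image of a nonassociative monomial. -/
def mon : FreeMagma X →ₙ* FreeJordanAlgebra k X := FreeMagma.lift (of k X)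

@[simp]
theorem mon_of (x : X) : mon k (FreeMagma.of x) = of k X x := rfl

theorem proj_single (m : FreeMagma X) (c : k) :
    proj k (MonoidAlgebra.single m c) = c • mon k m := by
  have h1 : proj k (MonoidAlgebra.single m 1) = mon k m := by
    induction m using FreeMagma.recOnMul with
    | ih1 x => rfl
    | ih2 x y hx hy =>
      rw [map_mul, ← hx, ← hy, ← map_mul, MonoidAlgebra.single_mul_single, one_mul]
  rw [← h1, ← map_smul, MonoidAlgebra.smul_single, smul_eq_mul, mul_one]

theorem exists_eq_sum_mon (w : FreeJordanAlgebra k X) :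
    ∃ (S : Finset (FreeMagma X)) (c : FreeMagma X → k), w = ∑ m ∈ S, c m • mon k m := by
  have h : w ∈ Submodule.span k (Set.range (mon k : FreeMagma X → FreeJordanAlgebra k X)) := by
    obtain ⟨a, rfl⟩ : ∃ a, proj k a = w := Quot.mk_surjective w
    induction a using MonoidAlgebra.induction_linear with
    | zero => rw [map_zero]; exact zero_mem _
    | add a b ha hb => rw [map_add]; exact add_mem ha hb
    | single m c =>
      rw [proj_single]
      exact Submodule.smul_mem _ _ (Submodule.subset_span ⟨m, rfl⟩)
  obtain ⟨c, hc⟩ := Finsupp.mem_span_range_iff_exists_finsupp.1 h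
  exact ⟨c.support, c, hc.symm⟩

/-- Elements of a free Jordan algebra are obtained from the generators by the operations. -/
theorem induction_on {p : FreeJordanAlgebra k X → Prop} (hof : ∀ x, p (of k X x))
    (hzero : p 0) (hadd : ∀ a b, p a → p b → p (a + b)) (hsmul : ∀ (c : k) a, p a → p (c • a))
    (hmul : ∀ a b, p a → p b → p (a * b)) (w : FreeJordanAlgebra k X) : p w := by
  obtain ⟨S, c, rfl⟩ := exists_eq_sum_mon k w
  refine Finset.sum_induction _ p hadd hzero fun m _ => hsmul _ _ ?_
  clear * - hof hmul
  induction m using FreeMagma.recOnMul with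
  | ih1 x => exact hof x
  | ih2 x y hx hy => rw [map_mul]; exact hmul _ _ hx hy

end Lift

/-! ### Semilinear automorphisms of free algebras. -/

section Twist

/-- The free Jordan algebra with scalars acting through an automorphism of the field. -/
def Twist (k : Type u) [Field k] (X : Type) (_ : RingAut k) : Type u := FreeJordanAlgebra k X

variable {k : Type u} [Field k] {X : Type} (φ : RingAut k)

instance : NonUnitalNonAssocCommRing (Twist k X φ) :=
  inferInstanceAs (NonUnitalNonAssocCommRing (FreeJordanAlgebra k X))

instance : IsCommJordan (Twist k X φ) := inferInstanceAs (IsCommJordan (FreeJordanAlgebra k X))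

instance : Module k (Twist k X φ) :=
  Module.compHom (FreeJordanAlgebra k X) (φ : k →+* k)

instance : IsScalarTower k (Twist k X φ) (Twist k X φ) where
  smul_assoc t a b := smul_mul_assoc (φ t) (show FreeJordanAlgebra k X from a) b

instance : SMulCommClass k (Twist k X φ) (Twist k X φ) where
  smul_comm t a b := (mul_smul_comm (φ t) (show FreeJordanAlgebra k X from a) b).symm

/-- The semilinear endomorphism of the free Jordan algebra that fixes the generators. -/
def twist : FreeJordanAlgebra k X →ₙ+* FreeJordanAlgebra k X :=
  ((lift k (A := Twist k X φ) (of k X) :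
    FreeJordanAlgebra k X →ₙₐ[k] Twist k X φ) : FreeJordanAlgebra k X →ₙ+* Twist k X φ)

@[simp]
theorem twist_of (x : X) : twist φ (of k X x) = of k X x :=
  lift_of k (A := Twist k X φ) (of k X) x

@[simp]
theorem twist_smul (c : k) (a : FreeJordanAlgebra k X) : twist φ (c • a) = φ c • twist φ a :=
  map_smul (lift k (A := Twist k X φ) (of k X)) c a

theorem twist_twist (ψ : RingAut k) (a : FreeJordanAlgebra k X) :
    twist φ (twist ψ a) = twist (φ * ψ) a := by
  induction a using induction_on with
  | hof x => simp
  | hzero => simp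
  | hadd a b ha hb => simp [ha, hb]
  | hsmul c a ha => simp [ha]
  | hmul a b ha hb => simp [ha, hb]

theorem twist_one (a : FreeJordanAlgebra k X) : twist (1 : RingAut k) a = a := by
  induction a using induction_on with
  | hof x => simp
  | hzero => simp
  | hadd a b ha hb => simp [ha, hb]
  | hsmul c a ha => simp [ha]
  | hmul a b ha hb => simp [ha, hb]

@[simp]
theorem twist_inv_twist (a : FreeJordanAlgebra k X) : twist φ⁻¹ (twist φ a) = a := by
  rw [twist_twist, inv_mul_cancel, twist_one]

@[simp]
theorem twist_twist_inv (a : FreeJordanAlgebra k X) : twist φ (twist φ⁻¹ a) = a := by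
  rw [twist_twist, mul_inv_cancel, twist_one]

end Twist

end FreeJordanAlgebra

/-! ### Rank one: polynomials without constant term. -/

namespace FreeJordanAlgebra

variable (k : Type u) [Field k] {X : Type}

open Polynomial in
/-- Evaluation of all generators at the polynomial variable. -/
def toPolynomial (X : Type) : FreeJordanAlgebra k X →ₙₐ[k] k[X] := lift k fun _ => Polynomial.X

@[simp]
theorem toPolynomial_of (x : X) : toPolynomial k X (of k X x) = Polynomial.X := lift_of k _ x

theorem of_ne_zero (x : X) : of k X x ≠ 0 := fun h => by
  simpa using congrArg (toPolynomial k X) h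

theorem of_mul_of_ne_zero (x y : X) : of k X x * of k X y ≠ 0 := fun h => by
  simpa using congrArg (toPolynomial k X) h

theorem toPolynomial_jordanPow (x : X) (n : ℕ) :
    toPolynomial k X (jordanPow (of k X x) n) = Polynomial.X ^ (n + 1) := by
  induction n with
  | zero => simp [jordanPow]
  | succ n ih => rw [jordanPow, map_mul, ih, toPolynomial_of, ← pow_succ']

/-- There is no unit; this is what excludes the substitutions X ↦ cX + b with b ≠ 0. -/
theorem coeff_zero_toPolynomial (a : FreeJordanAlgebra k X) :
    (toPolynomial k X a).coeff 0 = 0 := by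
  induction a using induction_on with
  | hof x => simp
  | hzero => simp
  | hadd a b ha hb => simp [ha, hb]
  | hsmul c a ha => simp [ha]
  | hmul a b ha hb => simp [ha]

variable {k}

theorem two_nsmul_eq_zero [CharZero k] (z : FreeJordanAlgebra k X) (h : 2 • z = 0) : z = 0 := by
  have h' : (2 : k) • z = 0 := by rw [two_smul, ← two_nsmul]; exact h
  exact (smul_eq_zero.1 h').resolve_left two_ne_zero

variable (k)

open Polynomial in
/-- The linear map sending the `n`-th power of the polynomial variable to the `n`-th power of a
generator. -/
def ofPolynomial (x : X) : k[X] →ₗ[k] FreeJordanAlgebra k X :=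
  -- The value 0 at exponent 0 is arbitrary: constant terms do not occur in the image of
  -- `toPolynomial`.
  (Polynomial.basisMonomials k).constr k fun n => Nat.casesOn n 0 (jordanPow (of k X x))

theorem ofPolynomial_X_pow (x : X) (n : ℕ) :
    ofPolynomial k x (Polynomial.X ^ (n + 1)) = jordanPow (of k X x) n := by
  have h := (Polynomial.basisMonomials k).constr_basis k
    (fun n => Nat.casesOn n 0 (jordanPow (of k X x)) : ℕ → FreeJordanAlgebra k X) (n + 1)
  rw [Polynomial.coe_basisMonomials] at h
  rw [Polynomial.X_pow_eq_monomial]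
  exact h

/-- By power associativity the powers of the generator span, so `toPolynomial` loses nothing in rank
one. -/
theorem ofPolynomial_toPolynomial [CharZero k] [Subsingleton X] (x : X)
    (a : FreeJordanAlgebra k X) : ofPolynomial k x (toPolynomial k X a) = a := by
  have hspan : a ∈ Submodule.span k (Set.range (jordanPow (of k X x))) := by
    induction a using induction_on with
    | hof y => rw [Subsingleton.elim y x]; exact Submodule.subset_span ⟨0, rfl⟩
    | hzero => exact zero_mem _
    | hadd a b ha hb => exact add_mem ha hb
    | hsmul c a ha => exact Submodule.smul_mem _ c ha
    | hmul a b ha hb =>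
      induction ha using Submodule.span_induction with
      | zero => rw [zero_mul]; exact zero_mem _
      | add a a' _ _ h h' => rw [add_mul]; exact add_mem h h'
      | smul c a _ h => rw [smul_mul_assoc]; exact Submodule.smul_mem _ c h
      | mem a ha =>
        obtain ⟨m, rfl⟩ := ha
        induction hb using Submodule.span_induction with
        | zero => rw [mul_zero]; exact zero_mem _
        | add b b' _ _ h h' => rw [mul_add]; exact add_mem h h'
        | smul c b _ h => rw [mul_smul_comm]; exact Submodule.smul_mem _ c h
        | mem b hb =>
          obtain ⟨n, rfl⟩ := hb
          rw [jordanPow_mul two_nsmul_eq_zero]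
          exact Submodule.subset_span ⟨_, rfl⟩
  induction hspan using Submodule.span_induction with
  | zero => simp
  | add a a' _ _ h h' => rw [map_add, map_add, h, h']
  | smul c a _ h => rw [map_smul, map_smul, h]
  | mem a ha =>
    obtain ⟨m, rfl⟩ := ha
    rw [toPolynomial_jordanPow, ofPolynomial_X_pow]

variable {k}

theorem toPolynomial_map [Subsingleton X] {Y : Type} (x : X)
    (f : FreeJordanAlgebra k X →ₙₐ[k] FreeJordanAlgebra k Y) (a : FreeJordanAlgebra k X) :
    toPolynomial k Y (f a) = (toPolynomial k X a).comp (toPolynomial k Y (f (of k X x))) := by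
  induction a using induction_on with
  | hof y => rw [Subsingleton.elim y x]; simp
  | hzero => simp
  | hadd a b ha hb => simp [ha, hb]
  | hsmul c a ha => simp [ha]
  | hmul a b ha hb => simp [ha, hb]

/-- Invertible endomorphisms of the free Jordan algebra of rank one are homotheties. -/
theorem exists_eq_smul_of [CharZero k] [Subsingleton X] (x : X)
    (f g : FreeJordanAlgebra k X →ₙₐ[k] FreeJordanAlgebra k X) (h : f (g (of k X x)) = of k X x) :
    ∃ c : k, c ≠ 0 ∧ g (of k X x) = c • of k X x := by
  set q := g (of k X x) with hq
  -- The hypothesis becomes X = Q ∘ P with Q the polynomial of `q`. Degrees multiply, so Q has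
  -- degree one.
  have h1 := toPolynomial_map x f q
  rw [h, toPolynomial_of] at h1
  have hdeg := congrArg Polynomial.natDegree h1
  rw [Polynomial.natDegree_X, Polynomial.natDegree_comp] at hdeg
  have hdq : (toPolynomial k X q).natDegree = 1 := Nat.eq_one_of_mul_eq_one_right hdeg.symm
  have hQ := Polynomial.eq_X_add_C_of_natDegree_le_one hdq.le
  rw [coeff_zero_toPolynomial, map_zero, add_zero, ← Polynomial.smul_eq_C_mul] at hQ
  have hqx : q = (toPolynomial k X q).coeff 1 • of k X x := by
    conv_lhs => rw [← ofPolynomial_toPolynomial k x q, hQ, map_smul, ← pow_one Polynomial.X]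
    rw [ofPolynomial_X_pow]
    rfl
  refine ⟨_, fun h0 => ?_, hqx⟩
  rw [h0, zero_smul] at hqx
  rw [hqx, map_zero] at h
  exact of_ne_zero k x h.symm

/-- A free Jordan algebra that is a retract of one of rank at most one has rank at most one. -/
theorem subsingleton_of_retract {Y : Type} [Subsingleton X]
    (r : FreeJordanAlgebra k Y →ₙₐ[k] FreeJordanAlgebra k X)
    (i : FreeJordanAlgebra k X →ₙₐ[k] FreeJordanAlgebra k Y) (h : ∀ a, i (r a) = a) :
    Subsingleton Y := by
  classical
  refine ⟨fun m n => by_contra fun hmn => ?_⟩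
  have hne : Nonempty X := by
    by_contra hX
    rw [not_nonempty_iff] at hX
    have h0 : r = 0 := by
      ext a
      obtain ⟨S, c, hs⟩ := exists_eq_sum_mon k (r a)
      have : IsEmpty (FreeMagma X) := ⟨fun t => by
        induction t using FreeMagma.recOnMul with
        | ih1 x => exact isEmptyElim x
        | ih2 _ _ h _ => exact h⟩
      rw [hs, Finset.eq_empty_of_isEmpty S]; simp
    have := h (of k Y m)
    rw [h0] at this
    exact of_ne_zero k m (this.symm.trans (map_zero i))
  obtain ⟨x⟩ := hne
  let D (m : Y) : FreeJordanAlgebra k Y →ₙₐ[k] FreeJordanAlgebra k X :=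
    lift k fun y => if y = m then of k X x else 0
  -- The chain rule at 0 writes the identity matrix on `Y` as a column times a row. Its rank is then
  -- at most one, so `Y` has at most one element.
  have key (m y : Y) : (toPolynomial k X (r (of k Y y))).coeff 1 *
      (toPolynomial k X (D m (i (of k X x)))).coeff 1 = if y = m then 1 else 0 := by
    have h1 := toPolynomial_map x ((D m).comp i) (r (of k Y y))
    have h2 : (D m).comp i (r (of k Y y)) = if y = m then of k X x else 0 := by
      change D m (i (r (of k Y y))) = _
      rw [h]; exact lift_of k _ y
    rw [h2] at h1
    have h3 := congrArg (fun P => (Polynomial.derivative P).eval 0) h1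
    change _ = ((Polynomial.derivative ((toPolynomial k X (r (of k Y y))).comp
      (toPolynomial k X (D m (i (of k X x)))))).eval 0) at h3
    rw [Polynomial.derivative_comp, Polynomial.eval_mul, Polynomial.eval_comp,
      ← Polynomial.coeff_zero_eq_eval_zero (toPolynomial k X (D m (i (of k X x)))),
      coeff_zero_toPolynomial, ← Polynomial.coeff_zero_eq_eval_zero,
      ← Polynomial.coeff_zero_eq_eval_zero, ← Polynomial.coeff_zero_eq_eval_zero,
      Polynomial.coeff_derivative,
      Polynomial.coeff_derivative, Polynomial.coeff_derivative] at h3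
    simp only [Nat.cast_zero, zero_add, mul_one] at h3
    rw [mul_comm, ← h3]
    split_ifs <;> simp
  have hmm := key m m
  have hnn := key n n
  have hmn' := key m n
  rw [if_pos rfl] at hmm hnn
  rw [if_neg (Ne.symm hmn)] at hmn'
  rcases mul_eq_zero.1 hmn' with h0 | h0
  · rw [h0, zero_mul] at hnn; exact zero_ne_one hnn
  · rw [h0, mul_zero] at hmm; exact zero_ne_one hmm

/-! ### Homogeneous elements, detected by scaling. -/

section Homogeneous

variable (k)

/-- The endomorphism multiplying each generator by a scalar. -/
def scale (t : X → k) : FreeJordanAlgebra k X →ₙₐ[k] FreeJordanAlgebra k X :=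
  lift k fun x => t x • of k X x

variable {k}

@[simp]
theorem scale_of (t : X → k) (x : X) : scale k t (of k X x) = t x • of k X x := lift_of k _ x

/-- The degree of a monomial with respect to the given degrees of the generators. -/
def monDegree (d : X → ℕ) : FreeMagma X → ℕ
  | .of x => d x
  | .mul a b => monDegree d a + monDegree d b

theorem scale_mon (d : X → ℕ) (t : k) (m : FreeMagma X) :
    scale k (fun x => t ^ d x) (mon k m) = t ^ monDegree d m • mon k m := by
  induction m using FreeMagma.recOnMul with
  | ih1 x => exact scale_of _ x
  | ih2 a b ha hb =>
    rw [map_mul, map_mul, ha, hb, smul_mul_smul_comm, ← pow_add]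
    rfl

/-- After applying a linear functional, both sides are polynomials in `t` agreeing on an infinite
field; the coefficients of t are compared. The vectors need not be independent, so no basis of the
free Jordan algebra is needed. -/
theorem sum_eq_sum_filter [Infinite k] {ι V : Type*} [AddCommGroup V] [Module k V] (S : Finset ι)
    (d : ι → ℕ) (v : ι → V) (h : ∀ t : k, ∑ i ∈ S, t ^ d i • v i = t • ∑ i ∈ S, v i) :
    ∑ i ∈ S, v i = ∑ i ∈ S with d i = 1, v i := by
  rw [← sub_eq_zero, ← Module.forall_dual_apply_eq_zero_iff k]
  intro f
  have hP : (∑ i ∈ S, Polynomial.monomial (d i) (f (v i))) =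
      Polynomial.monomial 1 (f (∑ i ∈ S, v i)) := by
    refine Polynomial.funext fun t => ?_
    rw [Polynomial.eval_finsetSum, Polynomial.eval_monomial, pow_one, mul_comm, ← smul_eq_mul,
      ← map_smul, ← h, map_sum]
    refine Finset.sum_congr rfl fun i _ => ?_
    rw [Polynomial.eval_monomial, map_smul, smul_eq_mul, mul_comm]
  have h1 := congrArg (Polynomial.coeff · 1) hP
  simp only [Polynomial.finsetSum_coeff, Polynomial.coeff_monomial, if_pos] at h1
  rw [map_sub, ← h1, map_sum, Finset.sum_filter, sub_self]

theorem sum_mon_eq_sum_filter [Infinite k] (d : X → ℕ) (S : Finset (FreeMagma X))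
    (c : FreeMagma X → k)
    (h : ∀ t : k, scale k (fun x => t ^ d x) (∑ m ∈ S, c m • mon k m) =
      t • ∑ m ∈ S, c m • mon k m) :
    ∑ m ∈ S, c m • mon k m = ∑ m ∈ S with monDegree d m = 1, c m • mon k m := by
  refine sum_eq_sum_filter (k := k) S (monDegree d) _ fun t => ?_
  rw [← h, map_sum]
  refine Finset.sum_congr rfl fun m _ => ?_
  rw [map_smul, scale_mon, smul_comm]

theorem monDegree_one_pos (m : FreeMagma X) : 0 < monDegree (fun _ => 1) m := by
  induction m using FreeMagma.recOnMul with
  | ih1 x => exact one_pos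
  | ih2 a b ha hb => exact Nat.add_pos_left ha _

theorem eq_of_of_monDegree_one (m : FreeMagma X) (h : monDegree (fun _ => 1) m = 1) :
    ∃ x, m = FreeMagma.of x := by
  cases m with
  | of x => exact ⟨x, rfl⟩
  | mul a b =>
    have ha := monDegree_one_pos a
    have hb := monDegree_one_pos b
    change monDegree _ a + monDegree _ b = 1 at h
    omega

theorem exists_eq_add_of_scale [Infinite k] {x y : X} (hxy : ∀ z, z = x ∨ z = y)
    (w : FreeJordanAlgebra k X) (h : ∀ t : k, scale k (fun _ => t) w = t • w) :
    ∃ α β : k, w = α • of k X x + β • of k X y := by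
  suffices w ∈ Submodule.span k {of k X x, of k X y} by
    obtain ⟨α, β, h⟩ := Submodule.mem_span_pair.1 this
    exact ⟨α, β, h.symm⟩
  obtain ⟨S, c, rfl⟩ := exists_eq_sum_mon k w
  rw [sum_mon_eq_sum_filter (fun _ => 1) S c (by simpa only [pow_one] using h)]
  refine Submodule.sum_mem _ fun m hm => Submodule.smul_mem _ _ ?_
  obtain ⟨z, rfl⟩ := eq_of_of_monDegree_one m (Finset.mem_filter.1 hm).2
  rcases hxy z with rfl | rfl <;> exact Submodule.subset_span (by simp)

theorem exists_eq_smul_mul_of_scale [Infinite k] [DecidableEq X] {x y : X} (hne : x ≠ y)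
    (hxy : ∀ z, z = x ∨ z = y) (w : FreeJordanAlgebra k X)
    (hx : ∀ t : k, scale k (fun z => if z = x then t else 1) w = t • w)
    (hy : ∀ t : k, scale k (fun z => if z = y then t else 1) w = t • w) :
    ∃ γ : k, w = γ • (of k X x * of k X y) := by
  suffices w ∈ Submodule.span k {of k X x * of k X y} by
    obtain ⟨γ, h⟩ := Submodule.mem_span_singleton.1 this
    exact ⟨γ, h.symm⟩
  obtain ⟨S, c, rfl⟩ := exists_eq_sum_mon k w
  have hd (t : k) (a : X) : (fun z => if z = a then t else 1) =
      fun z : X => t ^ (if z = a then 1 else 0) := by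
    funext z; split_ifs <;> simp
  simp only [hd] at hx hy
  rw [sum_mon_eq_sum_filter _ S c hx] at hy ⊢
  rw [sum_mon_eq_sum_filter _ _ c hy]
  refine Submodule.sum_mem _ fun m hm => Submodule.smul_mem _ _ ?_
  have hmx := (Finset.mem_filter.1 (Finset.mem_filter.1 hm).1).2
  have hmy := (Finset.mem_filter.1 hm).2
  -- A monomial of degree one in each of `x` and `y` has total degree two, hence is a product of two
  -- generators.
  have htot (m : FreeMagma X) : monDegree (fun _ => 1) m =
      monDegree (fun z => if z = x then 1 else 0) m +
        monDegree (fun z => if z = y then 1 else 0) m := by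
    induction m using FreeMagma.recOnMul with
    | ih1 z =>
      rcases hxy z with rfl | rfl
      · simp [monDegree, hne]
      · simp [monDegree, hne.symm]
    | ih2 a b ha hb =>
      change monDegree _ a + monDegree _ b = monDegree _ a + monDegree _ b +
        (monDegree _ a + monDegree _ b)
      omega
  cases m with
  | of z =>
    have := htot (.of z)
    rw [hmx, hmy] at this
    simp [monDegree] at this
  | mul a b =>
    have ha := monDegree_one_pos a
    have hb := monDegree_one_pos b
    have ha' := htot a
    have hb' := htot b
    have h2 : monDegree (fun _ => 1) a + monDegree (fun _ => 1) b = 2 := by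
      have := htot (.mul a b)
      rwa [hmx, hmy] at this
    obtain ⟨a, rfl⟩ := eq_of_of_monDegree_one a (by omega)
    obtain ⟨b, rfl⟩ := eq_of_of_monDegree_one b (by omega)
    simp only [monDegree] at hmx hmy
    rw [FreeMagma.mul_eq, map_mul, mon_of, mon_of]
    rcases hxy a with rfl | rfl <;> rcases hxy b with rfl | rfl
    · simp at hmx
    · exact Submodule.subset_span rfl
    · rw [mul_comm]; exact Submodule.subset_span rfl
    · simp at hmy

end Homogeneous

end FreeJordanAlgebra

/-! ### Elements and pairs of elements as morphisms. -/

namespace FreeJordanCat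

open FreeJordanAlgebra

variable {k : Type u} [Field k]

/-- The homomorphism of algebras underlying a morphism. -/
def toHom {A B : FreeJordanCat k} (f : A ⟶ B) : A.algebra k →ₙₐ[k] B.algebra k := f

@[simp]
theorem toHom_comp {A B C : FreeJordanCat k} (f : A ⟶ B) (g : B ⟶ C) (a : A.algebra k) :
    toHom (f ≫ g) a = toHom g (toHom f a) := rfl

@[simp]
theorem toHom_id (A : FreeJordanCat k) (a : A.algebra k) : toHom (𝟙 A) a = a := rfl

theorem hom_ext_of {A B : FreeJordanCat k} {f g : A ⟶ B}
    (h : ∀ x, toHom f (of k A.gens x) = toHom g (of k A.gens x)) : f = g :=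
  FreeJordanAlgebra.hom_ext (k := k) h

variable (k) in
/-- The free algebra of rank one. -/
def line : FreeJordanCat k := ⟨{0}⟩

variable (k) in
/-- The free algebra of rank two. -/
def plane : FreeJordanCat k := ⟨{0, 1}⟩

instance : Unique (line k).gens := inferInstanceAs (Unique ({0} : Finset ℕ))

variable (k) in
/-- The generator of the free algebra of rank one. -/
abbrev gen : (line k).algebra k := of k (line k).gens default

/-- The homomorphism from the free algebra of rank one given by an element. -/
def point {A : FreeJordanCat k} (a : A.algebra k) : line k ⟶ A :=
  FreeJordanAlgebra.lift k fun _ => a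

@[simp]
theorem toHom_point {A : FreeJordanCat k} (a : A.algebra k) (x : (line k).gens) :
    toHom (point a) (of k (line k).gens x) = a := lift_of k _ x

theorem point_comp {A B : FreeJordanCat k} (a : A.algebra k) (f : A ⟶ B) :
    point a ≫ f = point (toHom f a) :=
  hom_ext_of fun x => by simp

theorem point_toHom {A : FreeJordanCat k} (f : line k ⟶ A) : point (toHom f (gen k)) = f :=
  hom_ext_of fun x => by rw [Subsingleton.elim x default, toHom_point]

variable (k) in
/-- The first generator of the free algebra of rank two. -/
def genX : (plane k).gens := ⟨0, by simp [plane]⟩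

variable (k) in
/-- The second generator of the free algebra of rank two. -/
def genY : (plane k).gens := ⟨1, by simp [plane]⟩

theorem genX_ne_genY : genX k ≠ genY k := fun h => zero_ne_one (congrArg Subtype.val h)

theorem eq_genX_or_genY (z : (plane k).gens) : z = genX k ∨ z = genY k := by
  obtain ⟨z, hz⟩ := z
  simp only [plane, Finset.mem_insert, Finset.mem_singleton] at hz
  exact hz.imp Subtype.ext Subtype.ext

/-- The homomorphism from the free algebra of rank two given by two elements. -/
def pair {A : FreeJordanCat k} (a b : A.algebra k) : plane k ⟶ A :=
  FreeJordanAlgebra.lift k fun z => if z = genX k then a else b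

@[simp]
theorem toHom_pair_genX {A : FreeJordanCat k} (a b : A.algebra k) :
    toHom (pair a b) (of k (plane k).gens (genX k)) = a :=
  (lift_of k _ (genX k)).trans (if_pos rfl)

@[simp]
theorem toHom_pair_genY {A : FreeJordanCat k} (a b : A.algebra k) :
    toHom (pair a b) (of k (plane k).gens (genY k)) = b :=
  (lift_of k _ (genY k)).trans (if_neg genX_ne_genY.symm)

theorem nonempty_gens_of_nontrivial {A : FreeJordanCat k} {f g : A ⟶ A} (h : f ≠ g) :
    Nonempty A.gens := by
  by_contra hA
  rw [not_nonempty_iff] at hA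
  exact h (hom_ext_of fun x => isEmptyElim x)

theorem id_line_ne : 𝟙 (line k) ≠ point 0 := fun h => by
  have := congrArg (fun f => toHom f (gen k)) h
  exact of_ne_zero k _ (this.trans (toHom_point _ _))

/-! ### Action of an autoequivalence on elements, scalars and operations. -/

section Equivalence

variable (Φ : FreeJordanCat k ⥤ FreeJordanCat k) [Φ.IsEquivalence]

theorem nonempty_gens_obj_line : Nonempty (Φ.obj (line k)).gens :=
  nonempty_gens_of_nontrivial (f := Φ.map (𝟙 _)) (g := Φ.map (point 0))
    fun h => id_line_ne (Φ.map_injective h)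

theorem subsingleton_gens_obj_line : Subsingleton (Φ.obj (line k)).gens := by
  let N := Φ.objPreimage (line k)
  let e : Φ.obj N ≅ line k := Φ.objObjPreimageIso (line k)
  obtain ⟨n⟩ : Nonempty N.gens := by
    -- The zero endomorphism of the line pulls back to an endomorphism of `N` other than the
    -- identity, so `N` is nonzero.
    obtain ⟨z, hz⟩ := Φ.map_surjective (e.hom ≫ point 0 ≫ e.inv)
    refine nonempty_gens_of_nontrivial (f := 𝟙 N) (g := z) fun h => id_line_ne (k := k) ?_
    rw [← h, Φ.map_id, ← Category.assoc, Iso.eq_comp_inv, Category.id_comp] at hz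
    rw [← cancel_epi e.hom, ← hz, Category.comp_id]
  let i : line k ⟶ N := point (of k N.gens n)
  let r : N ⟶ line k := FreeJordanAlgebra.lift k fun _ => gen k
  have hir : i ≫ r = 𝟙 _ := by
    rw [point_comp, ← point_toHom (𝟙 (line k))]
    exact congrArg point (lift_of k _ n)
  refine subsingleton_of_retract (toHom (Φ.map i ≫ e.hom)) (toHom (e.inv ≫ Φ.map r)) fun a => ?_
  rw [← toHom_comp, Category.assoc, e.hom_inv_id_assoc, ← Φ.map_comp, hir, Φ.map_id, toHom_id]

/-- The generator of the image of the free algebra of rank one. -/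
def imageGen : (Φ.obj (line k)).gens := (nonempty_gens_obj_line Φ).some

/-- The bijection between an algebra and its image given by points. -/
def transport {A : FreeJordanCat k} (a : A.algebra k) : (Φ.obj A).algebra k :=
  toHom (Φ.map (point a)) (of k _ (imageGen Φ))

theorem toHom_map_transport {A B : FreeJordanCat k} (f : A ⟶ B) (a : A.algebra k) :
    toHom (Φ.map f) (transport Φ a) = transport Φ (toHom f a) := by
  rw [transport, transport, ← toHom_comp, ← Φ.map_comp, point_comp]

theorem transport_injective (A : FreeJordanCat k) :
    Function.Injective (transport Φ : A.algebra k → _) := by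
  intro a b h
  have := subsingleton_gens_obj_line Φ
  have h1 : Φ.map (point a) = Φ.map (point b) := hom_ext_of fun x => by
    rw [Subsingleton.elim x (imageGen Φ)]; exact h
  rw [← toHom_point a default, ← toHom_point b default, Φ.map_injective h1]

theorem transport_surjective (A : FreeJordanCat k) :
    Function.Surjective (transport Φ : A.algebra k → _) := by
  intro b
  have := subsingleton_gens_obj_line Φ
  obtain ⟨f, hf⟩ := Φ.map_surjective
    (FreeJordanAlgebra.lift k fun _ => b : Φ.obj (line k) ⟶ Φ.obj A)
  refine ⟨toHom f (gen k), ?_⟩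
  rw [transport, point_toHom, hf]
  exact lift_of k _ _

variable [CharZero k]

/-- Scaling by `c` is precomposition with an automorphism of the line, whose image under `Φ` is
again a homothety. One `d` therefore serves all objects. -/
theorem exists_transport_smul_of_ne_zero (c : k) (hc : c ≠ 0) :
    ∃ d : k, d ≠ 0 ∧ ∀ (A : FreeJordanCat k) (a : A.algebra k),
      transport Φ (c • a) = d • transport Φ a := by
  have := subsingleton_gens_obj_line Φ
  have hcomp : point (c • gen k) ≫ point (c⁻¹ • gen k) = 𝟙 (line k) := by
    rw [point_comp, map_smul, toHom_point, smul_smul, mul_inv_cancel₀ hc, one_smul,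
      ← point_toHom (𝟙 (line k)), toHom_id]
  obtain ⟨d, hd, h⟩ := exists_eq_smul_of (imageGen Φ) (toHom (Φ.map (point (c⁻¹ • gen k))))
    (toHom (Φ.map (point (c • gen k)))) (by
      rw [← toHom_comp, ← Φ.map_comp, hcomp, Φ.map_id, toHom_id])
  refine ⟨d, hd, fun A a => ?_⟩
  have h2 : point (c • a) = point (c • gen k) ≫ point a := by
    rw [point_comp, map_smul, toHom_point]
  rw [transport, h2, Φ.map_comp, toHom_comp, h, map_smul, transport]

theorem transport_zero (A : FreeJordanCat k) : transport Φ (0 : A.algebra k) = 0 := by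
  -- Any scalar other than 0 and 1 would do: zero is fixed by this homothety, while injectivity
  -- forces `d ≠ 1`.
  obtain ⟨d, -, hd⟩ := exists_transport_smul_of_ne_zero Φ 2 two_ne_zero
  have h0 := hd A 0
  rw [smul_zero] at h0
  have h1 : (1 - d) • transport Φ (0 : A.algebra k) = 0 := by
    rw [sub_smul, one_smul, ← h0, sub_self]
  refine (smul_eq_zero.1 h1).resolve_left fun h => ?_
  obtain rfl : d = 1 := (sub_eq_zero.1 h).symm
  have h2 := hd _ (gen k)
  rw [one_smul] at h2
  have h3 := transport_injective Φ _ h2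
  rw [two_smul, add_eq_left] at h3
  exact of_ne_zero k _ h3

theorem transport_gen_ne_zero : transport Φ (gen k) ≠ 0 := fun h =>
  of_ne_zero k _ (transport_injective Φ _ (h.trans (transport_zero Φ _).symm))

theorem exists_transport_smul (c : k) :
    ∃ d : k, ∀ (A : FreeJordanCat k) (a : A.algebra k),
      transport Φ (c • a) = d • transport Φ a := by
  by_cases hc : c = 0
  · exact ⟨0, fun A a => by rw [hc, zero_smul, zero_smul, transport_zero]⟩
  · obtain ⟨d, -, h⟩ := exists_transport_smul_of_ne_zero Φ c hc
    exact ⟨d, h⟩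

/-- The permutation of the scalars induced by an autoequivalence. -/
def scalarMap (c : k) : k := (exists_transport_smul Φ c).choose

theorem transport_smul (c : k) {A : FreeJordanCat k} (a : A.algebra k) :
    transport Φ (c • a) = scalarMap Φ c • transport Φ a :=
  (exists_transport_smul Φ c).choose_spec A a

theorem transport_add {A : FreeJordanCat k} (a b : A.algebra k) :
    transport Φ (a + b) = transport Φ a + transport Φ b := by
  obtain ⟨w, hw⟩ := transport_surjective Φ (plane k)
    (transport Φ (of k _ (genX k)) + transport Φ (of k _ (genY k)))
  have hpair {A : FreeJordanCat k} (a b : A.algebra k) :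
      transport Φ (toHom (pair a b) w) = transport Φ a + transport Φ b := by
    rw [← toHom_map_transport, hw, map_add, toHom_map_transport, toHom_map_transport,
      toHom_pair_genX, toHom_pair_genY]
  -- Scaling both generators scales `w`, because transport turns homotheties into homotheties.
  -- Setting one variable to zero then fixes each coefficient.
  obtain ⟨α, β, rfl⟩ := exists_eq_add_of_scale eq_genX_or_genY w fun t => by
    apply transport_injective Φ
    have h1 : (scale k (fun _ => t) : _ →ₙₐ[k] (plane k).algebra k) =
        toHom (pair (t • of k _ (genX k)) (t • of k _ (genY k))) :=
      FreeJordanAlgebra.hom_ext fun z => by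
        rcases eq_genX_or_genY z with rfl | rfl <;> simp
    rw [h1, hpair, transport_smul, transport_smul, transport_smul, hw, smul_add]
  simp only [map_add, map_smul, toHom_pair_genX, toHom_pair_genY] at hpair
  have hα : α = 1 := by
    have h1 := hpair (gen k) 0
    rw [smul_zero, add_zero, transport_zero, add_zero] at h1
    have h2 := transport_injective Φ _ h1
    rw [← sub_eq_zero, ← one_smul k (gen k), smul_smul, mul_one, ← sub_smul, smul_eq_zero] at h2
    exact sub_eq_zero.1 (h2.resolve_right (of_ne_zero k _))
  have hβ : β = 1 := by
    have h1 := hpair 0 (gen k)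
    rw [smul_zero, zero_add, transport_zero, zero_add] at h1
    have h2 := transport_injective Φ _ h1
    rw [← sub_eq_zero, ← one_smul k (gen k), smul_smul, mul_one, ← sub_smul, smul_eq_zero] at h2
    exact sub_eq_zero.1 (h2.resolve_right (of_ne_zero k _))
  rw [← hpair, hα, hβ, one_smul, one_smul]

theorem exists_transport_mul : ∃ γ : k, γ ≠ 0 ∧ ∀ (A : FreeJordanCat k) (a b : A.algebra k),
    transport Φ (γ • (a * b)) = transport Φ a * transport Φ b := by
  obtain ⟨w, hw⟩ := transport_surjective Φ (plane k)
    (transport Φ (of k _ (genX k)) * transport Φ (of k _ (genY k)))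
  have hpair {A : FreeJordanCat k} (a b : A.algebra k) :
      transport Φ (toHom (pair a b) w) = transport Φ a * transport Φ b := by
    rw [← toHom_map_transport, hw, map_mul, toHom_map_transport, toHom_map_transport,
      toHom_pair_genX, toHom_pair_genY]
  obtain ⟨γ, rfl⟩ := exists_eq_smul_mul_of_scale genX_ne_genY eq_genX_or_genY w
    (fun t => by
      apply transport_injective Φ
      have h1 : (scale k (fun z => if z = genX k then t else 1) :
          _ →ₙₐ[k] (plane k).algebra k) =
          toHom (pair (t • of k _ (genX k)) (of k _ (genY k))) :=
        FreeJordanAlgebra.hom_ext fun z => by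
          rcases eq_genX_or_genY z with rfl | rfl <;> simp [genX_ne_genY.symm]
      rw [h1, hpair, transport_smul, transport_smul, hw, smul_mul_assoc])
    (fun t => by
      apply transport_injective Φ
      have h1 : (scale k (fun z => if z = genY k then t else 1) :
          _ →ₙₐ[k] (plane k).algebra k) =
          toHom (pair (of k _ (genX k)) (t • of k _ (genY k))) :=
        FreeJordanAlgebra.hom_ext fun z => by
          rcases eq_genX_or_genY z with rfl | rfl <;> simp [genX_ne_genY]
      rw [h1, hpair, transport_smul, transport_smul, hw, mul_smul_comm])
  simp only [map_smul, map_mul, toHom_pair_genX, toHom_pair_genY] at hpair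
  refine ⟨γ, ?_, fun A => hpair⟩
  rintro rfl
  -- If `γ` vanished, all products in the image would vanish, yet the square of a generator is
  -- nonzero.
  obtain ⟨b, hb⟩ := transport_surjective Φ (line k) (of k _ (imageGen Φ))
  have h := hpair b b
  rw [hb, zero_smul, transport_zero] at h
  exact of_mul_of_ne_zero k _ _ h.symm

theorem smul_transport_gen_injective :
    Function.Injective fun c : k => c • transport Φ (gen k) :=
  smul_left_injective k (transport_gen_ne_zero Φ)

/-- The homotheties by `d` and `d⁻¹` pull back to endomorphisms of the line with composite the
identity, which forces a homothety. -/
theorem scalarMap_surjective : Function.Surjective (scalarMap Φ) := by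
  intro d
  by_cases hd : d = 0
  · refine ⟨0, smul_transport_gen_injective Φ ?_⟩
    change scalarMap Φ 0 • _ = d • _
    rw [← transport_smul, zero_smul, transport_zero, hd, zero_smul]
  obtain ⟨p, hp⟩ := transport_surjective Φ _ (d • transport Φ (gen k))
  obtain ⟨q, hq⟩ := transport_surjective Φ _ (d⁻¹ • transport Φ (gen k))
  obtain ⟨c, -, h⟩ := exists_eq_smul_of (default : (line k).gens) (toHom (point q))
    (toHom (point p)) (by
      apply transport_injective Φ
      rw [toHom_point, ← toHom_map_transport, hp, map_smul, toHom_map_transport, toHom_point, hq,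
        smul_smul, mul_inv_cancel₀ hd, one_smul])
  rw [toHom_point] at h
  refine ⟨c, smul_transport_gen_injective Φ ?_⟩
  change scalarMap Φ c • _ = d • _
  rw [← transport_smul, ← h, hp]

/-- The automorphism of the field of scalars induced by an autoequivalence. -/
def scalarAut : RingAut k :=
  RingEquiv.ofBijective
    ({ toFun := scalarMap Φ
       map_one' := smul_transport_gen_injective Φ <| by
        change scalarMap Φ 1 • _ = (1 : k) • _
        rw [← transport_smul, one_smul, one_smul]
       map_mul' := fun a b => smul_transport_gen_injective Φ <| by
        change scalarMap Φ (a * b) • _ = (scalarMap Φ a * scalarMap Φ b) • _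
        rw [← transport_smul, mul_smul, mul_smul, transport_smul, transport_smul]
       map_zero' := smul_transport_gen_injective Φ <| by
        change scalarMap Φ 0 • _ = (0 : k) • _
        rw [← transport_smul, zero_smul, zero_smul, transport_zero]
       map_add' := fun a b => smul_transport_gen_injective Φ <| by
        change scalarMap Φ (a + b) • _ = (scalarMap Φ a + scalarMap Φ b) • _
        rw [← transport_smul, add_smul, add_smul, transport_add, transport_smul,
          transport_smul] } : k →+* k)
    ⟨RingHom.injective _, scalarMap_surjective Φ⟩

theorem exists_semilinear_equiv : ∃ s : ∀ A : FreeJordanCat k,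
    A.algebra k ≃+* (Φ.obj A).algebra k,
    (∀ A (c : k) (a : A.algebra k), s A (c • a) = scalarAut Φ c • s A a) ∧
      ∀ A B (f : A ⟶ B) (a : A.algebra k), toHom (Φ.map f) (s A a) = s B (toHom f a) := by
  obtain ⟨γ, hγ, h⟩ := exists_transport_mul Φ
  -- Since κT(ab) = T(a)T(b), the rescaled map κ⁻¹T is multiplicative.
  set κ := scalarAut Φ γ with hκ
  have hκ0 : κ ≠ 0 := (map_ne_zero_iff _ (scalarAut Φ).injective).2 hγ
  have hmul {A : FreeJordanCat k} (a b : A.algebra k) :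
      κ • transport Φ (a * b) = transport Φ a * transport Φ b := by
    rw [← h, transport_smul]; rfl
  refine ⟨fun A =>
    { Equiv.ofBijective (fun a => κ⁻¹ • transport Φ a)
        ⟨fun a b hab => transport_injective Φ A (smul_right_injective _ (inv_ne_zero hκ0) hab),
          fun b => ?_⟩ with
      map_mul' := fun a b => ?_
      map_add' := fun a b => ?_ }, fun A c a => ?_, fun A B f a => ?_⟩
  · obtain ⟨a, ha⟩ := transport_surjective Φ A (κ • b)
    exact ⟨a, by simp only [ha, smul_smul, inv_mul_cancel₀ hκ0, one_smul]⟩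
  · change κ⁻¹ • transport Φ (a * b) = (κ⁻¹ • transport Φ a) * (κ⁻¹ • transport Φ b)
    rw [smul_mul_smul_comm, ← hmul, smul_smul, mul_assoc, inv_mul_cancel₀ hκ0, mul_one]
  · change κ⁻¹ • transport Φ (a + b) = κ⁻¹ • transport Φ a + κ⁻¹ • transport Φ b
    rw [transport_add, smul_add]
  · change κ⁻¹ • transport Φ (c • a) = scalarMap Φ c • κ⁻¹ • transport Φ a
    rw [transport_smul, smul_comm]
  · change toHom (Φ.map f) (κ⁻¹ • transport Φ a) = κ⁻¹ • transport Φ (toHom f a)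
    rw [map_smul, toHom_map_transport]

end Equivalence

end FreeJordanCat

/-! ### Twist functors and the classification of automorphisms. -/

namespace FreeJordanCat

open FreeJordanAlgebra

variable {k : Type u} [Field k]

/-- The isomorphism given by a bijective homomorphism. -/
def isoOfBijective {A B : FreeJordanCat k} (f : A ⟶ B) (hf : Function.Bijective (toHom f)) :
    A ≅ B where
  hom := f
  inv := NonUnitalAlgHom.inverse (toHom f) (Equiv.ofBijective _ hf).symm
    (Equiv.ofBijective _ hf).left_inv (Equiv.ofBijective _ hf).right_inv
  hom_inv_id := NonUnitalAlgHom.ext (Equiv.ofBijective _ hf).left_inv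
  inv_hom_id := NonUnitalAlgHom.ext (Equiv.ofBijective _ hf).right_inv

/-- The automorphism of the category twisting morphisms by an automorphism of the field. -/
def twistFunctor (φ : RingAut k) : FreeJordanCat k ⥤ FreeJordanCat k where
  obj A := A
  map {A B} f :=
    ({ toFun := fun a => twist φ (toHom f (twist φ⁻¹ a))
       map_smul' := fun c a => by
        rw [twist_smul, map_smul, twist_smul, ← RingAut.mul_apply, mul_inv_cancel]
        rfl
       map_zero' := by simp only [map_zero]
       map_add' := fun a b => by simp only [map_add]
       map_mul' := fun a b => by simp only [map_mul] } : A.algebra k →ₙₐ[k] B.algebra k)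
  map_id A := NonUnitalAlgHom.ext fun a => twist_twist_inv φ a
  map_comp f g := NonUnitalAlgHom.ext fun a => by
    change twist φ (toHom g (toHom f (twist φ⁻¹ a))) =
      twist φ (toHom g (twist φ⁻¹ (twist φ (toHom f (twist φ⁻¹ a)))))
    rw [twist_inv_twist]

theorem twistFunctor_comp (φ ψ : RingAut k) :
    twistFunctor ψ ⋙ twistFunctor φ = twistFunctor (φ * ψ) := by
  refine CategoryTheory.Functor.hext (fun A => rfl) fun A B f => heq_of_eq ?_
  refine NonUnitalAlgHom.ext fun (a : A.algebra k) => ?_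
  change twist φ (twist ψ (toHom f (twist ψ⁻¹ (twist φ⁻¹ a)))) =
    twist (φ * ψ) (toHom f (twist (φ * ψ)⁻¹ a))
  rw [twist_twist, twist_twist, mul_inv_rev]

theorem twistFunctor_one : twistFunctor (1 : RingAut k) = 𝟭 _ := by
  refine CategoryTheory.Functor.hext (fun A => rfl) fun A B f => heq_of_eq ?_
  refine NonUnitalAlgHom.ext fun (a : A.algebra k) => ?_
  change twist 1 (toHom f (twist 1⁻¹ a)) = toHom f a
  rw [inv_one, twist_one, twist_one]

variable (k) in
/-- The action of the automorphisms of the field on the category. -/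
def twistHom : RingAut k →* AutGroup k where
  toFun φ :=
    { hom := (twistFunctor φ).toCatHom
      inv := (twistFunctor φ⁻¹).toCatHom
      hom_inv_id := Cat.Hom.ext <| by
        change twistFunctor φ ⋙ twistFunctor φ⁻¹ = 𝟭 _
        rw [twistFunctor_comp, inv_mul_cancel, twistFunctor_one]
      inv_hom_id := Cat.Hom.ext <| by
        change twistFunctor φ⁻¹ ⋙ twistFunctor φ = 𝟭 _
        rw [twistFunctor_comp, mul_inv_cancel, twistFunctor_one] }
  map_one' := Aut.ext <| Cat.Hom.ext twistFunctor_one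
  map_mul' φ ψ := Aut.ext <| Cat.Hom.ext (twistFunctor_comp φ ψ).symm

variable [CharZero k]

theorem eq_one_of_twistHom_mem (φ : RingAut k) (h : twistHom k φ ∈ innerSubgroup k) : φ = 1 := by
  obtain ⟨e⟩ := h
  replace e : 𝟭 (FreeJordanCat k) ≅ twistFunctor φ := e
  let f : line k ⟶ line k := e.hom.app (line k)
  let g : line k ⟶ line k := e.inv.app (line k)
  have hfg : f ≫ g = 𝟙 (line k) := e.hom_inv_id_app (line k)
  obtain ⟨d, hd, hf⟩ := exists_eq_smul_of (default : (line k).gens) (toHom g) (toHom f)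
    (by rw [← toHom_comp, hfg, toHom_id])
  ext c
  have h1 := congrArg (fun t : line k ⟶ line k => toHom t (gen k))
    (e.hom.naturality (point (c • gen k)))
  change toHom f (toHom (point (c • gen k)) (gen k)) =
    twist φ (toHom (point (c • gen k)) (twist φ⁻¹ (toHom f (gen k)))) at h1
  rw [toHom_point, map_smul, hf, twist_smul, map_smul, twist_smul, twist_of, toHom_point,
    twist_smul, twist_of, ← RingAut.mul_apply, mul_inv_cancel, smul_smul, smul_smul,
    RingAut.one_apply] at h1
  have h2 := smul_left_injective k (of_ne_zero k _) h1
  rw [mul_comm] at h2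
  exact (mul_left_cancel₀ hd h2).symm

/-- Composing the semilinear isomorphism with the inverse twist cancels the semilinearity and leaves
a `k`-linear natural isomorphism. -/
theorem nonempty_twistFunctor_iso (Φ : FreeJordanCat k ⥤ FreeJordanCat k) [Φ.IsEquivalence] :
    Nonempty (twistFunctor (scalarAut Φ) ≅ Φ) := by
  obtain ⟨s, hs, hnat⟩ := exists_semilinear_equiv Φ
  set φ := scalarAut Φ
  let η (A : FreeJordanCat k) : A ⟶ Φ.obj A :=
    ({ toFun := fun a => s A (twist φ⁻¹ a)
       map_smul' := fun c a => by
        rw [twist_smul, hs, ← RingAut.mul_apply, mul_inv_cancel]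
        rfl
       map_zero' := by simp only [map_zero]
       map_add' := fun a b => by simp only [map_add]
       map_mul' := fun a b => by simp only [map_mul] } :
      A.algebra k →ₙₐ[k] (Φ.obj A).algebra k)
  have hη (A : FreeJordanCat k) : Function.Bijective (toHom (η A)) :=
    (s A).bijective.comp (Function.bijective_iff_has_inverse.2
      ⟨twist φ, twist_twist_inv φ, twist_inv_twist φ⟩)
  refine ⟨NatIso.ofComponents (fun A => isoOfBijective (η A) (hη A)) fun {A B} f => ?_⟩
  refine NonUnitalAlgHom.ext fun a => ?_
  change s B (twist φ⁻¹ (twist φ (toHom f (twist φ⁻¹ a)))) =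
    toHom (Φ.map f) (s A (twist φ⁻¹ a))
  rw [twist_inv_twist, hnat]

theorem exists_mk_twistHom_eq (Φ : AutGroup k) :
    ∃ φ, (twistHom k φ)⁻¹ * Φ ∈ innerSubgroup k := by
  let F : FreeJordanCat k ⥤ FreeJordanCat k := Φ.hom.toFunctor
  have : F.IsEquivalence := (Cat.equivOfIso Φ).isEquivalence_functor
  obtain ⟨e⟩ := nonempty_twistFunctor_iso F
  -- Products in `Aut` compose from right to left, so the element in question is `F` followed by the
  -- inverse twist.
  refine ⟨scalarAut F, ⟨eqToIso ?_ ≪≫ Functor.isoWhiskerRight e (twistFunctor (scalarAut F)⁻¹)⟩⟩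
  rw [twistFunctor_comp, inv_mul_cancel, twistFunctor_one]

end FreeJordanCat

end

theorem mainTheorem4 (k : Type u) [Field k] [CharZero k] :
    Nonempty ((FreeJordanCat.AutGroup k ⧸ FreeJordanCat.innerSubgroup k) ≃* RingAut k) := by
  refine ⟨(MulEquiv.ofBijective ((QuotientGroup.mk' (FreeJordanCat.innerSubgroup k)).comp
    (FreeJordanCat.twistHom k)) ⟨?_, ?_⟩).symm⟩
  · refine (injective_iff_map_eq_one _).2 fun φ hφ => FreeJordanCat.eq_one_of_twistHom_mem φ ?_
    exact (QuotientGroup.eq_one_iff _).1 hφ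
  · intro q
    obtain ⟨Φ, rfl⟩ := QuotientGroup.mk_surjective q
    obtain ⟨φ, hφ⟩ := FreeJordanCat.exists_mk_twistHom_eq Φ
    exact ⟨φ, QuotientGroup.eq.2 hφ⟩
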